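/- For an integer $t\ge 0$ let $P_5^{t}$ denote the caterpillar obtained from a path of length $4$ (that is, on $5$ vertices) by attaching $t$ pendant edges to each of its three internal vertices. A finite simple graph $G$ is called $H$-saturated if $G$ contains no copy of $H$ as a (not necessarily induced) subgraph, but adding to $G$ any edge between two distinct nonadjacent vertices creates a copy of $H$; let $\operatorname{sat}(n,H)$ be the minimum number of edges of an $H$-saturated graph with $n$ vertices. Theorem. For any integer $s\ge 1$ and any integer $n \ge q(2s+4)+s+1$, where $q=\max\{2,\lfloor (s-1)/2\rfloor\}$, $$\left(s+\frac{2}{s+3}\right)\frac n2-c_1\;\le\;\operatorname{sat}(n,P_5^{s-1})\;\le\;\left(s+\frac{2}{s+2}\right)\frac n2+c_2,$$ where $c_1=\dfrac{2s+3}{2s+6}+\dfrac{(s+1)^2}{8}$ and $c_2=\dfrac{s(s+1)}{s+2}$. -/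

import Mathlib

namespace SaturationNumber

open SimpleGraph

/-- `G` is `H`-saturated: it contains no copy of `H` (as a not necessarily induced subgraph), but
adding any new edge between two distinct nonadjacent vertices creates one. -/
def IsSaturated {W V : Type*} (H : SimpleGraph W) (G : SimpleGraph V) : Prop :=
  H.Free G ∧ ∀ x y : V, x ≠ y → ¬ G.Adj x y → ¬ H.Free (G ⊔ SimpleGraph.edge x y)

/-- The saturation number `sat(n, H)`: the minimum number of edges of an `H`-saturated graph of
order `n`. The minimum is over a nonempty set whenever `H` has an edge, see `exists_isSaturated`. -/
noncomputable def sat {W : Type*} (n : ℕ) (H : SimpleGraph W) : ℕ :=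
  sInf {m : ℕ | ∃ G : SimpleGraph (Fin n), IsSaturated H G ∧ G.edgeSet.ncard = m}

theorem exists_isSaturated {W V : Type*} [Finite V] (H : SimpleGraph W) (hH : H ≠ ⊥) :
    ∃ G : SimpleGraph V, IsSaturated H G := by
  obtain ⟨G, hG⟩ := (Set.toFinite {G : SimpleGraph V | H.Free G}).exists_maximal
    ⟨⊥, free_bot hH⟩
  refine ⟨G, hG.prop, fun x y hxy hadj hfree => hadj ?_⟩
  have hle : G ⊔ SimpleGraph.edge x y ≤ G := hG.le_of_ge hfree le_sup_left
  exact hle (Or.inr (by simp [SimpleGraph.edge_adj, hxy]))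

/-- The caterpillar `P₅ᵗ`: a path `0 - 1 - 2 - 3 - 4` of length `4` (the vertices `Sum.inl i`),
with `t` pendant edges attached to each of the three internal vertices `1, 2, 3` of the path: the
leaves `Sum.inr (k, a)`, for `a : Fin t`, are adjacent exactly to the path vertex `k + 1`. -/
def caterpillar (t : ℕ) : SimpleGraph (Fin 5 ⊕ Fin 3 × Fin t) where
  Adj
    | .inl i, .inl j => (pathGraph 5).Adj i j
    | .inl i, .inr (k, _) => i.val = k.val + 1
    | .inr (k, _), .inl i => i.val = k.val + 1
    | .inr _, .inr _ => False
  symm := ⟨by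
    rintro (i | ⟨k, a⟩) (j | ⟨l, b⟩) h
    · exact SimpleGraph.Adj.symm h
    · exact h
    · exact h
    · exact h⟩
  loopless := ⟨by
    rintro (i | ⟨k, a⟩) h
    · exact (pathGraph 5).irrefl h
    · exact h⟩

end SaturationNumber

open SimpleGraph Finset

/-! ### Caterpillars described by their spine -/

namespace SaturationNumber

/-! A copy of the caterpillar is a path of three vertices of degree at least `s + 1` (call such
vertices large) with disjoint leaf sets of sizes `s`, `s - 1`, `s`.

Lower bound: discharge the excess `degree - s` in a saturated graph. A vertex of degree `s` with a
large neighbour charges at least 2 units in total: one to each large neighbour, or two to its only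
one. With two more units for `b` itself, a large `b` carries at most `(s + 3) * (degree b - s)`, up
to two corrections (`weight_le`). One is for a `b` without large neighbours, and there is at most
one such `b` (`IsSaturated.eq_of_isolated`). The other is for a `b` of degree `s + 1` that is the
only large neighbour of several vertices of degree `s`. These vertices, those of degree less than
`s`, and those of degree `s` without large neighbours cannot enter the spine when two of them are
joined, so they form a clique of at most `s + 1` vertices (`adj_of_mem_inert`). The clique also
limits the total deficiency of the vertices of degree less than `s`. Summation gives
`IsSaturated.sum_degree_ge`.

Upper bound: if the large vertices ("centers") induce a matching, there is no spine (`base_free`).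
The base graph has this property, and all its other vertices have degree `s`, except for pendant
vertices that absorb a remainder. In a saturated extension every new edge meets a pendant vertex,
whose degree stays at most `s` (`base_adj_or_pendant`, `card_le_of_pendant_adj`), so the edges can
be counted without knowing the extension. A block of `2 * s + 4` vertices accounts for `1 + (s + 1)
^ 2` edges, which is the claimed density. -/

/-- The vertices `a`, `b`, `c` form a path, and `A`, `B`, `C` are sets of private leaves of them
that complete it to a caterpillar whose internal vertices all have degree `s + 1`. -/
structure IsCaterpillar {V : Type*} (G : SimpleGraph V) (s : ℕ) (a b c : V)
    (A B C : Finset V) : Prop where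
  adj_ab : G.Adj a b
  adj_bc : G.Adj b c
  ne_ac : a ≠ c
  adjA : ∀ v ∈ A, G.Adj a v ∧ v ≠ b ∧ v ≠ c
  adjB : ∀ v ∈ B, G.Adj b v ∧ v ≠ a ∧ v ≠ c
  adjC : ∀ v ∈ C, G.Adj c v ∧ v ≠ a ∧ v ≠ b
  cardA : #A = s
  cardB : #B + 1 = s
  cardC : #C = s
  disjAB : Disjoint A B
  disjAC : Disjoint A C
  disjBC : Disjoint B C

namespace IsCaterpillar

variable {V : Type*} {G G' : SimpleGraph V} {s : ℕ} {a b c : V} {A B C : Finset V}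

theorem reverse (h : IsCaterpillar G s a b c A B C) : IsCaterpillar G s c b a C B A where
  adj_ab := h.adj_bc.symm
  adj_bc := h.adj_ab.symm
  ne_ac := h.ne_ac.symm
  adjA v hv := ⟨(h.adjC v hv).1, (h.adjC v hv).2.2, (h.adjC v hv).2.1⟩
  adjB v hv := ⟨(h.adjB v hv).1, (h.adjB v hv).2.2, (h.adjB v hv).2.1⟩
  adjC v hv := ⟨(h.adjA v hv).1, (h.adjA v hv).2.2, (h.adjA v hv).2.1⟩
  cardA := h.cardC
  cardB := h.cardB
  cardC := h.cardA
  disjAB := h.disjBC.symm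
  disjAC := h.disjAC.symm
  disjBC := h.disjAB.symm

/-- Every edge of a caterpillar has an internal endpoint. -/
theorem of_adj (h : IsCaterpillar G s a b c A B C)
    (ha : ∀ v, G.Adj a v → G'.Adj a v) (hb : ∀ v, G.Adj b v → G'.Adj b v)
    (hc : ∀ v, G.Adj c v → G'.Adj c v) : IsCaterpillar G' s a b c A B C :=
  { h with
    adj_ab := ha _ h.adj_ab
    adj_bc := hb _ h.adj_bc
    adjA := fun v hv => ⟨ha _ (h.adjA v hv).1, (h.adjA v hv).2⟩
    adjB := fun v hv => ⟨hb _ (h.adjB v hv).1, (h.adjB v hv).2⟩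
    adjC := fun v hv => ⟨hc _ (h.adjC v hv).1, (h.adjC v hv).2⟩ }

/-- One vertex of `A` and one of `C` become the ends of the path; the remaining `s - 1` vertices of
each are pendant. -/
theorem not_free (h : IsCaterpillar G s a b c A B C) : ¬ (caterpillar (s - 1)).Free G := by
  classical
  have key : ∀ S : Finset V, #S = s → ∃ x ∈ S, ∃ f : Fin (s - 1) → V,
      Function.Injective f ∧ ∀ i, f i ∈ S ∧ f i ≠ x := by
    intro S hS
    have hpos : 0 < #S := by have := h.cardB; omega
    obtain ⟨x, hx⟩ := Finset.card_pos.mp hpos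
    have hc : #(S.erase x) = s - 1 := by rw [Finset.card_erase_of_mem hx, hS]
    let e := (S.erase x).equivFinOfCardEq hc
    refine ⟨x, hx, fun i => (e.symm i : V), fun i j hij => e.symm.injective (Subtype.ext hij),
      fun i => ?_⟩
    have := (e.symm i).2
    rw [Finset.mem_erase] at this
    exact ⟨this.2, this.1⟩
  obtain ⟨a₀, ha₀, f, hf, hfA⟩ := key A h.cardA
  obtain ⟨c₀, hc₀, k, hk, hkC⟩ := key C h.cardC
  have hBc : #B = s - 1 := by have := h.cardB; omega
  let e := B.equivFinOfCardEq hBc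
  obtain ⟨g, hg, hgB⟩ : ∃ g : Fin (s - 1) → V, Function.Injective g ∧ ∀ i, g i ∈ B :=
    ⟨fun i => (e.symm i : V), fun i j hij => e.symm.injective (Subtype.ext hij),
      fun i => (e.symm i).2⟩
  let φ : Fin 5 ⊕ Fin 3 × Fin (s - 1) → V
    | .inl i => ![a₀, a, b, c, c₀] i
    | .inr (i, j) => ![f j, g j, k j] i
  have hAB := Finset.disjoint_left.mp h.disjAB
  have hAC := Finset.disjoint_left.mp h.disjAC
  have hBC := Finset.disjoint_left.mp h.disjBC
  have nab := h.adj_ab.ne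
  have nbc := h.adj_bc.ne
  have nac := h.ne_ac
  have hA : ∀ v ∈ A, v ≠ a ∧ v ≠ b ∧ v ≠ c := fun v hv =>
    ⟨(h.adjA v hv).1.ne', (h.adjA v hv).2⟩
  have hB : ∀ v ∈ B, v ≠ a ∧ v ≠ b ∧ v ≠ c := fun v hv =>
    ⟨(h.adjB v hv).2.1, (h.adjB v hv).1.ne', (h.adjB v hv).2.2⟩
  have hC : ∀ v ∈ C, v ≠ a ∧ v ≠ b ∧ v ≠ c := fun v hv =>
    ⟨(h.adjC v hv).2.1, (h.adjC v hv).2.2, (h.adjC v hv).1.ne'⟩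
  have hφ : Function.Injective φ := by
    rintro (i | ⟨i, p⟩) (j | ⟨j, q⟩) hij
    · fin_cases i <;> fin_cases j <;> simp [φ] at hij ⊢ <;> grind
    · fin_cases i <;> fin_cases j <;> simp [φ] at hij ⊢ <;> grind
    · fin_cases i <;> fin_cases j <;> simp [φ] at hij ⊢ <;> grind
    · have hf' := @hf p q
      have hg' := @hg p q
      have hk' := @hk p q
      fin_cases i <;> fin_cases j <;> simp [φ] at hij ⊢ <;> grind
  have e0 := (h.adjA a₀ ha₀).1
  have e4 := (h.adjC c₀ hc₀).1
  have ef := fun j => (h.adjA _ (hfA j).1).1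
  have eg := fun j => (h.adjB _ (hgB j)).1
  have ek := fun j => (h.adjC _ (hkC j).1).1
  have e1 := h.adj_ab
  have e2 := h.adj_bc
  have hadj : ∀ {u v}, (caterpillar (s - 1)).Adj u v → G.Adj (φ u) (φ v) := by
    rintro (i | ⟨i, p⟩) (j | ⟨j, q⟩) hij
    · fin_cases i <;> fin_cases j <;>
        simp [caterpillar, pathGraph_adj] at hij <;> simp [φ, *, SimpleGraph.adj_comm]
    · fin_cases i <;> fin_cases j <;> simp [caterpillar] at hij <;> simp [φ, *]
    · fin_cases i <;> fin_cases j <;> simp [caterpillar] at hij <;>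
        simp [φ, *, (ef _).symm, (eg _).symm, (ek _).symm]
    · exact hij.elim
  exact fun hfree => hfree ⟨⟨⟨φ, hadj⟩, hφ⟩⟩

end IsCaterpillar

theorem exists_isCaterpillar_of_not_free {V : Type*} {G : SimpleGraph V} {s : ℕ} (hs : 1 ≤ s)
    (h : ¬ (caterpillar (s - 1)).Free G) :
    ∃ a b c A B C, IsCaterpillar G s a b c A B C := by
  classical
  obtain ⟨f⟩ : (caterpillar (s - 1)).IsContained G := not_not.mp h
  have hinj : Function.Injective f := f.injective
  have hadj : ∀ {u v}, (caterpillar (s - 1)).Adj u v → G.Adj (f u) (f v) :=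
    fun h => f.toHom.map_adj h
  let leaf (i : Fin 3) : Finset (Fin 5 ⊕ Fin 3 × Fin (s - 1)) := univ.image fun j => .inr (i, j)
  have hleaf : ∀ i, #(leaf i) = s - 1 := fun i => by
    rw [Finset.card_image_of_injective _ (fun p q h => by simpa using h)]; simp
  let F : (Fin 5 ⊕ Fin 3 × Fin (s - 1)) ↪ V := ⟨f, hinj⟩
  have hF : ∀ u, F u = f u := fun _ => rfl
  refine ⟨f (.inl 1), f (.inl 2), f (.inl 3), (insert (.inl 0) (leaf 0)).map F, (leaf 1).map F,
    (insert (.inl 4) (leaf 2)).map F, ?_⟩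
  constructor
  · exact hadj (by simp [caterpillar, pathGraph_adj])
  · exact hadj (by simp [caterpillar, pathGraph_adj])
  · simp [hinj.eq_iff]
  · simp [leaf, hF, hinj.eq_iff]
    exact ⟨hadj (by simp [caterpillar, pathGraph_adj]), fun i => hadj (by simp [caterpillar])⟩
  · simp [leaf, hF, hinj.eq_iff]
    exact fun i => hadj (by simp [caterpillar])
  · simp [leaf, hF, hinj.eq_iff]
    exact ⟨hadj (by simp [caterpillar, pathGraph_adj]), fun i => hadj (by simp [caterpillar])⟩
  · rw [Finset.card_map, Finset.card_insert_of_notMem (by simp [leaf]), hleaf]; omega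
  · rw [Finset.card_map, hleaf]; omega
  · rw [Finset.card_map, Finset.card_insert_of_notMem (by simp [leaf]), hleaf]; omega
  · rw [Finset.disjoint_map]; simp [leaf, Finset.disjoint_left]
  · rw [Finset.disjoint_map]; simp [leaf, Finset.disjoint_left]
  · rw [Finset.disjoint_map]; simp [leaf, Finset.disjoint_left]

namespace IsCaterpillar

variable {V : Type*} {G : SimpleGraph V} {s : ℕ} {a b c : V} {A B C : Finset V}

theorem exists_nhds_left [DecidableEq V] (h : IsCaterpillar G s a b c A B C) :
    #(insert b A) = s + 1 ∧ ∀ v ∈ insert b A, G.Adj a v := by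
  refine ⟨?_, ?_⟩
  · rw [Finset.card_insert_of_notMem (fun hb => (h.adjA b hb).2.1 rfl), h.cardA]
  · simpa using ⟨h.adj_ab, fun v hv => (h.adjA v hv).1⟩

theorem exists_nhds_middle [DecidableEq V] (h : IsCaterpillar G s a b c A B C) :
    #(insert a (insert c B)) = s + 1 ∧ ∀ v ∈ insert a (insert c B), G.Adj b v := by
  refine ⟨?_, ?_⟩
  · rw [Finset.card_insert_of_notMem, Finset.card_insert_of_notMem, h.cardB]
    · exact fun hc => (h.adjB c hc).2.2 rfl
    · rw [Finset.mem_insert]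
      rintro (hac | ha)
      · exact h.ne_ac hac
      · exact (h.adjB a ha).2.1 rfl
  · simpa using ⟨h.adj_ab.symm, h.adj_bc, fun v hv => (h.adjB v hv).1⟩

end IsCaterpillar

/-! ### Copies created by adding one edge -/

section AddEdge

variable {V : Type*} {G : SimpleGraph V} {s : ℕ} {x y : V}

theorem sup_edge_adj_iff (hxy : x ≠ y) {u v : V} :
    (G ⊔ SimpleGraph.edge x y).Adj u v ↔ G.Adj u v ∨ u = x ∧ v = y ∨ u = y ∧ v = x := by
  rw [sup_adj, edge_adj]
  grind

theorem adj_of_sup_edge_adj (hxy : x ≠ y) {u v : V} (hux : u ≠ x) (huy : u ≠ y)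
    (h : (G ⊔ SimpleGraph.edge x y).Adj u v) : G.Adj u v := by
  rw [sup_edge_adj_iff hxy] at h
  grind

theorem IsSaturated.exists_isCaterpillar (hs : 1 ≤ s) (hG : IsSaturated (caterpillar (s - 1)) G)
    (hxy : x ≠ y) (hadj : ¬ G.Adj x y) :
    ∃ a b c A B C, IsCaterpillar (G ⊔ SimpleGraph.edge x y) s a b c A B C :=
  exists_isCaterpillar_of_not_free hs (hG.2 x y hxy hadj)

variable [Fintype V] [DecidableRel G.Adj]

/-- Applied to a spine vertex off the new edge: all its edges are old, and if its degree is exactly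
`s + 1` the caterpillar uses every neighbour. -/
theorem card_nhds_of_ne (hxy : x ≠ y) {u : V} (hux : u ≠ x) (huy : u ≠ y) {S : Finset V}
    (hS : #S = s + 1 ∧ ∀ v ∈ S, (G ⊔ SimpleGraph.edge x y).Adj u v) :
    s + 1 ≤ G.degree u ∧ (∀ v ∈ S, G.Adj u v) ∧
      (G.degree u = s + 1 → ∀ v, G.Adj u v → v ∈ S) := by
  have hadj : ∀ v ∈ S, G.Adj u v := fun v hv => adj_of_sup_edge_adj hxy hux huy (hS.2 v hv)
  have hsub : S ⊆ G.neighborFinset u := fun v hv => by simpa using hadj v hv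
  refine ⟨?_, hadj, fun hd v hv => ?_⟩
  · rw [← hS.1, ← card_neighborFinset_eq_degree]
    exact Finset.card_le_card hsub
  · rw [Finset.eq_of_subset_of_card_le hsub (by rw [card_neighborFinset_eq_degree, hS.1, hd])]
    simpa using hv

/-- A vertex of degree at most `s` reaches the spine only by using the new edge together with all
its old ones. -/
theorem card_nhds_self [DecidableEq V] (hxy : x ≠ y) (hd : G.degree x ≤ s) {S : Finset V}
    (hS : #S = s + 1 ∧ ∀ v ∈ S, (G ⊔ SimpleGraph.edge x y).Adj x v) :
    G.degree x = s ∧ y ∈ S ∧ (∀ v, G.Adj x v → v ∈ S) := by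
  have hsub : S.erase y ⊆ G.neighborFinset x := fun v hv => by
    rw [Finset.mem_erase] at hv
    have := (sup_edge_adj_iff hxy).mp (hS.2 v hv.2)
    rw [mem_neighborFinset]
    grind
  have hle := Finset.card_le_card hsub
  rw [card_neighborFinset_eq_degree] at hle
  have hy : y ∈ S := by
    by_contra hy
    rw [Finset.erase_eq_of_notMem hy, hS.1] at hle
    omega
  rw [Finset.card_erase_of_mem hy, hS.1] at hle
  refine ⟨by omega, hy, fun v hv => ?_⟩
  have := Finset.eq_of_subset_of_card_le hsub
    (by rw [card_neighborFinset_eq_degree, Finset.card_erase_of_mem hy, hS.1]; omega)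
  have hv' : v ∈ S.erase y := by rw [this]; simpa using hv
  exact Finset.mem_of_mem_erase hv'

/-- The local structure at `x` that allows `x` to become an internal vertex of a caterpillar when
the edge from `x` to `y` is added. -/
def Activates (G : SimpleGraph V) [DecidableRel G.Adj] (s : ℕ) (x y : V) : Prop :=
  G.degree x = s ∧ ∃ z, s + 1 ≤ G.degree z ∧ G.Adj x z ∧
    ((∃ z', z' ≠ z ∧ s + 1 ≤ G.degree z' ∧ G.Adj x z') ∨
      (G.degree z = s + 1 →
        (∀ t, G.Adj x t → G.Adj z t → s + 1 ≤ G.degree t) ∧ ¬ G.Adj z y))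

/-- The witness is `z = c`, with `z' = a` if `a ≠ y`. If `a = y` and `c` has degree `s + 1`, all
neighbours of both `x` and `c` are used, so a common neighbour would be a leaf of both, and `c`
cannot be adjacent to `y`, which is already on the spine next to `x`. -/
theorem activates_of_middle (hxy : x ≠ y) (hx : G.degree x ≤ s) {a c : V} {A B C : Finset V}
    (h : IsCaterpillar (G ⊔ SimpleGraph.edge x y) s a x c A B C) (hc : c ≠ y) :
    Activates G s x y := by
  classical
  obtain ⟨hd, hy, hN⟩ := card_nhds_self hxy hx h.exists_nhds_middle
  have hcx := h.adj_bc.ne'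
  obtain ⟨hdc, hNc, hNc'⟩ := card_nhds_of_ne hxy hcx hc h.reverse.exists_nhds_left
  have hxc : G.Adj x c := (hNc x (Finset.mem_insert_self _ _)).symm
  refine ⟨hd, c, hdc, hxc, ?_⟩
  by_cases ha : a = y
  · subst ha
    refine Or.inr fun hc1 => ⟨fun t hxt hct => ?_, fun hca => ?_⟩
    · exfalso
      have h1 := hN t hxt
      have h2 := hNc' hc1 t hct
      have h3 := Finset.disjoint_left.mp h.disjBC
      have h4 := h.adjC t
      have h5 := hxt.ne
      have h6 := hct.ne
      grind
    · have h2 := hNc' hc1 a hca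
      have h4 := h.adjC a
      have h5 := h.adj_ab.ne
      grind
  · have hax := h.adj_ab.ne
    obtain ⟨hda, hNa, -⟩ := card_nhds_of_ne hxy hax ha h.exists_nhds_left
    exact Or.inl ⟨a, h.ne_ac, hda, (hNa x (Finset.mem_insert_self _ _)).symm⟩

/-- If `b = y`, then `y` is the middle vertex. Otherwise `z = b`, and when `b` has degree `s + 1`
its only possible common neighbour with `x` is the large vertex `c`. -/
theorem activates_of_left (hxy : x ≠ y) (hx : G.degree x ≤ s) (hy : G.degree y ≤ s) {b c : V}
    {A B C : Finset V} (h : IsCaterpillar (G ⊔ SimpleGraph.edge x y) s x b c A B C) :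
    Activates G s x y ∨ Activates G s y x := by
  classical
  by_cases hb : b = y
  · subst hb
    right
    rw [SimpleGraph.edge_comm] at h
    exact activates_of_middle hxy.symm hy h h.ne_ac.symm
  left
  obtain ⟨hd, hyA, hN⟩ := card_nhds_self hxy hx h.exists_nhds_left
  have hyA' : y ∈ A := by grind
  have hcy : c ≠ y := fun hc => (h.adjA y hyA').2.2 hc.symm
  have hbx := h.adj_ab.ne'
  obtain ⟨hdb, hNb, hNb'⟩ := card_nhds_of_ne hxy hbx hb h.exists_nhds_middle
  obtain ⟨hdc, hNc, -⟩ := card_nhds_of_ne hxy h.ne_ac.symm hcy h.reverse.exists_nhds_left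
  refine ⟨hd, b, hdb, (hNb x (Finset.mem_insert_self _ _)).symm, Or.inr fun hb1 =>
    ⟨fun t hxt hbt => ?_, fun hby => ?_⟩⟩
  · have h1 := hN t hxt
    have h2 := hNb' hb1 t hbt
    have h3 := Finset.disjoint_left.mp h.disjAB
    have h5 := hxt.ne
    have h6 := hbt.ne
    grind
  · have h2 := hNb' hb1 y hby
    have h3 := Finset.disjoint_left.mp h.disjAB
    grind

/-- Every edge of a caterpillar meets the spine, so a copy whose spine avoids `x` and `y` would
already lie in `G`. -/
theorem IsSaturated.activates (hs : 1 ≤ s) (hG : IsSaturated (caterpillar (s - 1)) G)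
    (hxy : x ≠ y) (hadj : ¬ G.Adj x y) (hx : G.degree x ≤ s) (hy : G.degree y ≤ s) :
    Activates G s x y ∨ Activates G s y x := by
  classical
  obtain ⟨a, b, c, A, B, C, h⟩ := hG.exists_isCaterpillar hs hxy hadj
  have h' := h
  rw [SimpleGraph.edge_comm] at h'
  by_cases hax : a = x
  · subst hax; exact activates_of_left hxy hx hy h
  by_cases hay : a = y
  · subst hay; exact (activates_of_left hxy.symm hy hx h').symm
  by_cases hcx : c = x
  · subst hcx; exact activates_of_left hxy hx hy h.reverse
  by_cases hcy : c = y
  · subst hcy; exact (activates_of_left hxy.symm hy hx h'.reverse).symm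
  by_cases hbx : b = x
  · subst hbx; exact Or.inl (activates_of_middle hxy hx h hcy)
  by_cases hby : b = y
  · subst hby; exact Or.inr (activates_of_middle hxy.symm hy h' hcx)
  exact absurd hG.1 (h.of_adj (fun v => adj_of_sup_edge_adj hxy hax hay)
    (fun v => adj_of_sup_edge_adj hxy hbx hby)
    (fun v => adj_of_sup_edge_adj hxy hcx hcy)).not_free

/-- At most one vertex of large degree has no neighbour of large degree. -/
theorem IsSaturated.eq_of_isolated (hs : 1 ≤ s) (hG : IsSaturated (caterpillar (s - 1)) G)
    (hx : s + 1 ≤ G.degree x) (hy : s + 1 ≤ G.degree y)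
    (hx' : ∀ z, G.Adj x z → G.degree z ≤ s) (hy' : ∀ z, G.Adj y z → G.degree z ≤ s) :
    x = y := by
  classical
  by_contra hxy
  have hadj : ¬ G.Adj x y := fun h => by have := hx' y h; omega
  obtain ⟨a, b, c, A, B, C, h⟩ := hG.exists_isCaterpillar hs hxy hadj
  have big : ∀ {u : V} {S : Finset V},
      (#S = s + 1 ∧ ∀ v ∈ S, (G ⊔ SimpleGraph.edge x y).Adj u v) → s + 1 ≤ G.degree u := by
    intro u S hS
    by_cases hux : u = x
    · rwa [hux]
    by_cases huy : u = y
    · rwa [huy]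
    exact (card_nhds_of_ne hxy hux huy hS).1
  have ha := big h.exists_nhds_left
  have hb := big h.exists_nhds_middle
  have hc := big h.reverse.exists_nhds_left
  have hab := (sup_edge_adj_iff hxy).mp h.adj_ab
  have hbc := (sup_edge_adj_iff hxy).mp h.adj_bc
  have hac := h.ne_ac
  have nadj : ∀ {u v : V}, G.Adj u v → s + 1 ≤ G.degree u → s + 1 ≤ G.degree v →
      u ≠ x ∧ u ≠ y ∧ v ≠ x ∧ v ≠ y := by
    intro u v huv hu hv
    refine ⟨?_, ?_, ?_, ?_⟩ <;> rintro rfl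
    · have := hx' _ huv; omega
    · have := hy' _ huv; omega
    · have := hx' _ huv.symm; omega
    · have := hy' _ huv.symm; omega
  have n1 := fun h => nadj (u := a) (v := b) h ha hb
  have n2 := fun h => nadj (u := b) (v := c) h hb hc
  -- If one spine edge were the new one, the other would be an old edge at `x` or `y` with two large
  -- ends, or the new edge again, contradicting `a ≠ c`.
  have hab' : G.Adj a b := by grind
  have hbc' : G.Adj b c := by grind
  obtain ⟨hax, hay, hbx, hby⟩ := n1 hab'
  obtain ⟨-, -, hcx, hcy⟩ := n2 hbc'
  exact absurd hG.1 (h.of_adj (fun v => adj_of_sup_edge_adj hxy hax hay)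
    (fun v => adj_of_sup_edge_adj hxy hbx hby)
    (fun v => adj_of_sup_edge_adj hxy hcx hcy)).not_free

end AddEdge

/-! ### The lower bound by discharging -/

section Counting

variable {V : Type*} [Fintype V] (G : SimpleGraph V) [DecidableRel G.Adj] (s : ℕ)

open Classical in
/-- The vertices of degree `s` whose only neighbour of degree greater than `s` is `b`. -/
noncomputable def exclusive (b : V) : Finset V :=
  {x | G.degree x = s ∧ G.Adj x b ∧ ∀ z, G.Adj x z → s + 1 ≤ G.degree z → z = b}

open Classical in
/-- The vertices that cannot become internal vertices of a caterpillar
when an edge between two of them is added. -/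
noncomputable def inert : Finset V :=
  {x | G.degree x < s ∨ (G.degree x = s ∧ ∀ z, G.Adj x z → G.degree z ≤ s) ∨
    ∃ b, G.degree b = s + 1 ∧ x ∈ exclusive G s b ∧ 2 ≤ #(exclusive G s b)}

variable {G s}

theorem mem_exclusive {b x : V} : x ∈ exclusive G s b ↔
    G.degree x = s ∧ G.Adj x b ∧ ∀ z, G.Adj x z → s + 1 ≤ G.degree z → z = b := by
  simp [exclusive]

theorem mem_inert {x : V} : x ∈ inert G s ↔
    G.degree x < s ∨ (G.degree x = s ∧ ∀ z, G.Adj x z → G.degree z ≤ s) ∨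
    ∃ b, G.degree b = s + 1 ∧ x ∈ exclusive G s b ∧ 2 ≤ #(exclusive G s b) := by
  simp [inert]

theorem degree_le_of_mem_inert {x : V} (hx : x ∈ inert G s) : G.degree x ≤ s := by
  rcases mem_inert.mp hx with h | h | ⟨b, -, h, -⟩
  · exact h.le
  · exact h.1.le
  · exact (mem_exclusive.mp h).1.le

theorem not_activates_of_mem_exclusive {b x y : V} (hb : G.degree b = s + 1)
    (hx : x ∈ exclusive G s b) (hy : y ∈ exclusive G s b) : ¬ Activates G s x y := by
  rintro ⟨-, z, hz, hxz, h⟩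
  obtain ⟨-, hxb, hu⟩ := mem_exclusive.mp hx
  obtain rfl := hu z hxz hz
  rcases h with ⟨z', hne, hz', hxz'⟩ | h
  · exact hne (hu z' hxz' hz')
  · exact (h hb).2 (mem_exclusive.mp hy).2.1.symm

variable (hs : 1 ≤ s) (hG : IsSaturated (caterpillar (s - 1)) G)
include hs hG

/-- Both vertices are adjacent to `b`, which violates the clause `¬ G.Adj z y` of `Activates`. -/
theorem adj_of_mem_exclusive {b x y : V} (hb : G.degree b = s + 1)
    (hx : x ∈ exclusive G s b) (hy : y ∈ exclusive G s b) (hxy : x ≠ y) : G.Adj x y := by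
  by_contra hadj
  rcases hG.activates hs hxy hadj (mem_exclusive.mp hx).1.le (mem_exclusive.mp hy).1.le with h | h
  · exact not_activates_of_mem_exclusive hb hx hy h
  · exact not_activates_of_mem_exclusive hb hy hx h

/-- In the third case another exclusive vertex `t` of `b` is adjacent to `x`, so `x` and `b` have a
common neighbour of degree only `s`. -/
theorem not_activates_of_mem_inert {x y : V} (hx : x ∈ inert G s) : ¬ Activates G s x y := by
  rintro ⟨hd, z, hz, hxz, h⟩
  rcases mem_inert.mp hx with hx | hx | ⟨b, hb, hx, hc⟩
  · omega
  · have := hx.2 z hxz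
    omega
  · obtain ⟨-, hxb, hu⟩ := mem_exclusive.mp hx
    obtain rfl := hu z hxz hz
    rcases h with ⟨z', hne, hz', hxz'⟩ | h
    · exact hne (hu z' hxz' hz')
    · obtain ⟨t, ht, htx⟩ := Finset.exists_mem_ne (Nat.lt_of_succ_le hc) x
      have hxt := adj_of_mem_exclusive hs hG hb hx ht htx.symm
      obtain ⟨htd, htz, -⟩ := mem_exclusive.mp ht
      have := (h hb).1 t hxt htz.symm
      omega

theorem adj_of_mem_inert {x y : V} (hx : x ∈ inert G s) (hy : y ∈ inert G s) (hxy : x ≠ y) :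
    G.Adj x y := by
  by_contra hadj
  rcases hG.activates hs hxy hadj (degree_le_of_mem_inert hx) (degree_le_of_mem_inert hy) with h | h
  · exact not_activates_of_mem_inert hs hG hx h
  · exact not_activates_of_mem_inert hs hG hy h

theorem card_inert_le_degree {x : V} (hx : x ∈ inert G s) : #(inert G s) ≤ G.degree x + 1 := by
  classical
  rw [← Finset.card_erase_add_one hx, ← card_neighborFinset_eq_degree]
  gcongr
  intro y hy
  rw [Finset.mem_erase] at hy
  simpa using adj_of_mem_inert hs hG hx hy.2 hy.1.symm

theorem card_inert_le : #(inert G s) ≤ s + 1 := by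
  rcases (inert G s).eq_empty_or_nonempty with h | ⟨x, hx⟩
  · simp [h]
  · have := card_inert_le_degree hs hG hx
    have := degree_le_of_mem_inert hx
    omega

omit hs hG in
/-- The weight covered by a vertex `b` of large degree is bounded by its excess degree, up to
corrections. -/
theorem weight_le [DecidableEq V] {b : V} (hb : s + 1 ≤ G.degree b) :
    (2 + #{x | G.degree x = s ∧ G.Adj x b} + #(exclusive G s b) : ℤ) ≤
      (s + 3) * (G.degree b - s) +
        (if G.degree b = s + 1 ∧ 2 ≤ #(exclusive G s b) then (#(exclusive G s b) : ℤ) else 0) +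
        (if ∀ z, G.Adj b z → G.degree z ≤ s then 1 else 0) := by
  have hem : #(exclusive G s b) ≤ #{x | G.degree x = s ∧ G.Adj x b} := by
    gcongr
    intro x hx
    simp only [Finset.mem_filter, Finset.mem_univ, true_and]
    exact ⟨(mem_exclusive.mp hx).1, (mem_exclusive.mp hx).2.1⟩
  have hsub : ({x | G.degree x = s ∧ G.Adj x b} : Finset V) ⊆ G.neighborFinset b := by
    intro x hx
    simp only [Finset.mem_filter, Finset.mem_univ, true_and] at hx
    simpa using hx.2.symm
  have hmd := Finset.card_le_card hsub
  rw [card_neighborFinset_eq_degree] at hmd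
  have hmd' : ¬ (∀ z, G.Adj b z → G.degree z ≤ s) →
      #{x | G.degree x = s ∧ G.Adj x b} + 1 ≤ G.degree b := by
    intro h
    push Not at h
    obtain ⟨z, hbz, hz⟩ := h
    rw [← card_neighborFinset_eq_degree]
    refine Finset.card_lt_card ⟨hsub, fun h => ?_⟩
    have := h (show z ∈ G.neighborFinset b by simpa using hbz)
    simp only [Finset.mem_filter, Finset.mem_univ, true_and] at this
    omega
  obtain ⟨j, hj⟩ := Nat.exists_eq_add_of_le hb
  -- For `degree b = s + 1` the budget is `s + 3 = 2 + s + 1`: at most `s` neighbours of degree `s`,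
  -- at most one of them exclusive, and the corrections pay for the exceptions. For larger degrees
  -- `2 + 2 * degree b` already fits, with slack `(s + 1) * (j - 1)`.
  rcases Nat.eq_zero_or_pos j with rfl | hj0
  · have hdb : (G.degree b : ℤ) = s + 1 := by omega
    rw [hdb]
    have : ((s : ℤ) + 3) * (s + 1 - s) = s + 3 := by ring
    rw [this]
    split_ifs with h1 h2 h2
    · omega
    · have := hmd' h2; omega
    · omega
    · have := hmd' h2; omega
  · have hdb : (G.degree b : ℤ) - s = j + 1 := by omega
    rw [hdb]
    have h1 : (2 : ℤ) + 2 * G.degree b ≤ (s + 3) * (j + 1) := by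
      have : (G.degree b : ℤ) = s + 1 + j := by omega
      rw [this]
      have hj1 : (1 : ℤ) ≤ j := by exact_mod_cast hj0
      nlinarith [mul_nonneg (show (0 : ℤ) ≤ s + 1 by positivity) (sub_nonneg.mpr hj1)]
    have h2 : (0 : ℤ) ≤ if G.degree b = s + 1 ∧ 2 ≤ #(exclusive G s b) then
        (#(exclusive G s b) : ℤ) else 0 := by
      split
      · exact Int.natCast_nonneg _
      · exact le_rfl
    have h3 : (0 : ℤ) ≤ if ∀ z, G.Adj b z → G.degree z ≤ s then 1 else 0 := by
      split
      · exact zero_le_one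
      · exact le_rfl
    omega

omit hs hG in
-- A vertex with two large neighbours is counted at each of them; one with a single large neighbour
-- is counted there twice, the second time as exclusive.
theorem two_mul_card_covered_le [DecidableEq V] :
    2 * #{x | G.degree x = s ∧ ∃ z, G.Adj x z ∧ s + 1 ≤ G.degree z} ≤
      ∑ b with s + 1 ≤ G.degree b,
        (#{x | G.degree x = s ∧ G.Adj x b} + #(exclusive G s b)) := by
  have h1 : ∀ b, #{x | G.degree x = s ∧ G.Adj x b} =
      ∑ x with G.degree x = s, if G.Adj x b then 1 else 0 := fun b => by
    rw [← Finset.filter_filter, Finset.card_filter]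
  have h2 : ∀ b, #(exclusive G s b) =
      ∑ x with G.degree x = s, if x ∈ exclusive G s b then 1 else 0 := fun b => by
    rw [← Finset.card_filter]
    congr 1
    ext x
    simp only [Finset.mem_filter, Finset.mem_univ, true_and]
    exact ⟨fun h => ⟨(mem_exclusive.mp h).1, h⟩, fun h => h.2⟩
  simp_rw [h1, h2, ← Finset.sum_add_distrib]
  rw [Finset.sum_comm, ← Finset.filter_filter, mul_comm, Finset.card_filter, Finset.sum_mul]
  refine Finset.sum_le_sum fun x hx => ?_
  split_ifs with hz
  swap
  · simp
  obtain ⟨z, hxz, hz⟩ := hz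
  have hxs : G.degree x = s := by simpa using hx
  rw [Finset.sum_add_distrib, ← Finset.card_filter, ← Finset.card_filter]
  by_cases hu : ∀ z', G.Adj x z' → s + 1 ≤ G.degree z' → z' = z
  · have e1 : 0 < #{b ∈ {b | s + 1 ≤ G.degree b} | G.Adj x b} :=
      Finset.card_pos.mpr ⟨z, by simp [hxz, Nat.lt_of_succ_le hz]⟩
    have e2 : 0 < #{b ∈ {b | s + 1 ≤ G.degree b} | x ∈ exclusive G s b} :=
      Finset.card_pos.mpr ⟨z, Finset.mem_filter.mpr ⟨by simpa using hz, mem_exclusive.mpr ⟨hxs, hxz, hu⟩⟩⟩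
    omega
  · push Not at hu
    obtain ⟨z', hxz', hz', hne⟩ := hu
    have e1 : 1 < #{b ∈ {b | s + 1 ≤ G.degree b} | G.Adj x b} :=
      Finset.one_lt_card.mpr ⟨z, by simp [hxz, Nat.lt_of_succ_le hz], z', by simp [hxz', Nat.lt_of_succ_le hz'], hne.symm⟩
    omega

omit hs hG in
-- The three kinds of inert vertices are disjoint, and so are the exclusive sets of different `b`,
-- by uniqueness of the large neighbour.
theorem sum_card_exclusive_add_le_card_inert [DecidableEq V] :
    ∑ b with s + 1 ≤ G.degree b,
        (if G.degree b = s + 1 ∧ 2 ≤ #(exclusive G s b) then #(exclusive G s b) else 0) +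
      #{x | G.degree x = s ∧ ¬ ∃ z, G.Adj x z ∧ s + 1 ≤ G.degree z} +
      #{x | G.degree x < s} ≤ #(inert G s) := by
  rw [← Finset.sum_filter, ← Finset.card_biUnion, ← Finset.card_union_of_disjoint,
    ← Finset.card_union_of_disjoint]
  · refine Finset.card_le_card fun x hx => ?_
    simp only [Finset.mem_union, Finset.mem_biUnion, Finset.mem_filter, Finset.mem_univ,
      true_and] at hx
    rw [mem_inert]
    rcases hx with (⟨b, hb, hx⟩ | hx) | hx
    · exact Or.inr (Or.inr ⟨b, hb.2.1, hx, hb.2.2⟩)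
    · refine Or.inr (Or.inl ⟨hx.1, fun z hz => ?_⟩)
      by_contra h
      exact hx.2 ⟨z, hz, by omega⟩
    · exact Or.inl hx
  · rw [Finset.disjoint_left]
    intro x hx
    simp only [Finset.mem_union, Finset.mem_biUnion, Finset.mem_filter, Finset.mem_univ,
      true_and] at hx ⊢
    rcases hx with ⟨b, -, hx⟩ | hx
    · exact (mem_exclusive.mp hx).1.not_lt
    · exact hx.1.not_lt
  · rw [Finset.disjoint_left]
    intro x hx
    simp only [Finset.mem_biUnion, Finset.mem_filter, Finset.mem_univ, true_and] at hx ⊢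
    obtain ⟨b, hb, hx⟩ := hx
    exact fun h => h.2 ⟨b, (mem_exclusive.mp hx).2.1, hb.1⟩
  · intro b hb b' hb' hne
    simp only [Finset.coe_filter, Finset.mem_filter, Finset.mem_univ, true_and,
      Set.mem_ofPred_eq] at hb hb'
    refine Finset.disjoint_left.mpr fun x hx hx' => hne ?_
    exact (mem_exclusive.mp hx').2.2 b (mem_exclusive.mp hx).2.1 hb.1

/-- If `l` vertices have degree below `s`, they lie in the inert clique and have degree at least `l
- 1`; and `4 * l * (s + 1 - l) ≤ (s + 1) ^ 2`. -/
theorem sum_deficiency_le :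
    4 * ∑ x with G.degree x < s, ((s : ℤ) - G.degree x) ≤ (s + 1) ^ 2 := by
  classical
  have hl : #{x | G.degree x < s} ≤ #(inert G s) :=
    Finset.card_le_card fun x hx => mem_inert.mpr (Or.inl (by simpa using hx))
  have : ∑ x with G.degree x < s, ((s : ℤ) - G.degree x) ≤
      ∑ x with G.degree x < s, ((s : ℤ) + 1 - #{x | G.degree x < s}) := by
    refine Finset.sum_le_sum fun x hx => ?_
    have := card_inert_le_degree hs hG (mem_inert.mpr (Or.inl (show G.degree x < s by simpa using hx)))
    omega
  rw [Finset.sum_const, nsmul_eq_mul] at this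
  nlinarith [sq_nonneg ((s : ℤ) + 1 - 2 * #{x | G.degree x < s})]

/-- The lower bound on the degree sum of a saturated graph. -/
theorem IsSaturated.sum_degree_ge :
    4 * (2 * Fintype.card V - (2 * s + 3)) - (s + 3) * (s + 1) ^ 2 ≤
      4 * (s + 3) * ∑ v, ((G.degree v : ℤ) - s) := by
  classical
  have hw := Finset.sum_le_sum fun b (hb : b ∈ ({b | s + 1 ≤ G.degree b} : Finset V)) =>
    weight_le (G := G) (s := s) (b := b) (by simpa using hb)
  have hc := two_mul_card_covered_le (G := G) (s := s)
  have hi := sum_card_exclusive_add_le_card_inert (G := G) (s := s)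
  have hi' := card_inert_le hs hG
  have hd := sum_deficiency_le hs hG
  have hiso : #{b ∈ {b | s + 1 ≤ G.degree b} | ∀ z, G.Adj b z → G.degree z ≤ s} ≤ 1 := by
    refine Finset.card_le_one.mpr fun x hx y hy => ?_
    simp only [Finset.mem_filter, Finset.mem_univ, true_and] at hx hy
    exact hG.eq_of_isolated hs hx.1 hy.1 hx.2 hy.2
  simp only [Finset.sum_add_distrib, ← Finset.mul_sum, Finset.sum_const, Finset.sum_boole] at hw
  rw [Finset.sum_add_distrib] at hc
  have hsplit1 := Finset.sum_filter_add_sum_filter_not univ (fun v => s + 1 ≤ G.degree v)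
    (fun v => ((G.degree v : ℤ) - s))
  have hsplit2 : ∑ v with ¬ s + 1 ≤ G.degree v, ((G.degree v : ℤ) - s) =
      - ∑ x with G.degree x < s, ((s : ℤ) - G.degree x) := by
    rw [← Finset.sum_neg_distrib]
    symm
    refine Finset.sum_subset_zero_on_sdiff (fun x hx => ?_) (fun x hx => ?_) fun _ _ => by ring
    · simp only [Finset.mem_filter, Finset.mem_univ, true_and] at hx ⊢
      omega
    · simp only [Finset.mem_sdiff, Finset.mem_filter, Finset.mem_univ, true_and] at hx
      omega
  have hcard : Fintype.card V = #{b | s + 1 ≤ G.degree b} +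
      (#{x | G.degree x = s ∧ ∃ z, G.Adj x z ∧ s + 1 ≤ G.degree z} +
        #{x | G.degree x = s ∧ ¬ ∃ z, G.Adj x z ∧ s + 1 ≤ G.degree z} +
        #{x | G.degree x < s}) := by
    have h1 := Finset.card_filter_add_card_filter_not (s := (univ : Finset V))
      (fun v => s + 1 ≤ G.degree v)
    have h2 := Finset.card_filter_add_card_filter_not
      (s := ({v | ¬ s + 1 ≤ G.degree v} : Finset V)) (fun v => G.degree v = s)
    have h3 := Finset.card_filter_add_card_filter_not (s := ({v | G.degree v = s} : Finset V))
      (fun x => ∃ z, G.Adj x z ∧ s + 1 ≤ G.degree z)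
    have h4 : ({v | ¬ s + 1 ≤ G.degree v} : Finset V).filter (fun v => G.degree v = s) =
        ({v | G.degree v = s} : Finset V) := by ext; simp; omega
    have h5 : ({v | ¬ s + 1 ≤ G.degree v} : Finset V).filter (fun v => ¬ G.degree v = s) =
        ({v | G.degree v < s} : Finset V) := by ext; simp; omega
    rw [h4, h5] at h2
    rw [Finset.filter_filter, Finset.filter_filter] at h3
    rw [← Finset.card_univ]
    omega
  replace hc := (Nat.cast_le (α := ℤ)).mpr hc
  replace hi := (Nat.cast_le (α := ℤ)).mpr hi
  replace hi' := (Nat.cast_le (α := ℤ)).mpr hi'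
  replace hiso := (Nat.cast_le (α := ℤ)).mpr hiso
  simp only [Nat.cast_add, Nat.cast_mul, Nat.cast_sum, Nat.cast_ite, Nat.cast_ofNat,
    Nat.cast_zero, Nat.cast_one] at hc hi hi' hiso
  rw [← hsplit1, hsplit2, hcard]
  simp only [nsmul_eq_mul] at hw
  set X := ∑ b with s + 1 ≤ G.degree b, ((G.degree b : ℤ) - s)
  set Y := ∑ x with G.degree x < s, ((s : ℤ) - G.degree x)
  have hY : (s + 3 : ℤ) * (4 * Y) ≤ (s + 3) * (s + 1) ^ 2 := by gcongr
  have hl : (0 : ℤ) ≤ #{x | G.degree x < s} := by positivity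
  have e : 4 * ((s : ℤ) + 3) * (X + -Y) = 4 * ((s + 3) * X) - (s + 3) * (4 * Y) := by ring
  rw [e]
  push_cast
  -- The exclusive correction enters once and the other inert vertices twice, so together they cost
  -- at most `2 * (s + 1)`; the isolated large vertex makes this `2 * s + 3`.
  have hA : (0 : ℤ) ≤ ∑ b with s + 1 ≤ G.degree b,
      if G.degree b = s + 1 ∧ 2 ≤ #(exclusive G s b) then (#(exclusive G s b) : ℤ) else 0 :=
    Finset.sum_nonneg fun b _ => by split; exacts [Int.natCast_nonneg _, le_rfl]
  linarith

end Counting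

/-! ### The base graph and its saturated extensions -/

section Construction

variable {K X : Type} (τ : K → K) (π : X → K) (F : SimpleGraph X) (c₀ : K) (κ ω : ℕ)

/-- The adjacencies of the base graph: centers matched by `τ`, leaves attached to centers by `π`
and joined to each other by `F`, a clique, and further vertices pendant at the center `c₀`. -/
def baseRel : K ⊕ X ⊕ Fin κ ⊕ Fin ω → K ⊕ X ⊕ Fin κ ⊕ Fin ω → Prop
  | .inl c, .inl d => d = τ c
  | .inl c, .inr (.inl x) => π x = c
  | .inr (.inl x), .inr (.inl y) => F.Adj x y
  | .inr (.inr (.inl _)), .inr (.inr (.inl _)) => True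
  | .inl c, .inr (.inr (.inr _)) => c = c₀
  | _, _ => False

/-- The base graph of the upper bound construction. -/
def base : SimpleGraph (K ⊕ X ⊕ Fin κ ⊕ Fin ω) := SimpleGraph.fromRel (baseRel τ π F c₀ κ ω)

/-- The conditions on the data of a base graph that make it almost saturated. -/
structure IsBaseData (s : ℕ) : Prop where
  involutive : Function.Involutive τ
  ne : ∀ c, τ c ≠ c
  card_nhds : ∀ x, ∃ N : Finset X, #N + 1 = s ∧ ∀ y, y ∈ N ↔ F.Adj x y
  adj : ∀ x y, F.Adj x y → π y ≠ π x ∧ π y ≠ τ (π x)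
  card_fiber : ∀ c, ∃ P : Finset X, s + 1 ≤ #P ∧ ∀ x ∈ P, π x = c
  card_clique : κ = 0 ∨ κ = s + 1

variable {τ π F c₀ κ ω} {s : ℕ} {G : SimpleGraph (K ⊕ X ⊕ Fin κ ⊕ Fin ω)}

theorem base_adj_center_center (h : IsBaseData τ π F κ s) {c d : K} :
    (base τ π F c₀ κ ω).Adj (.inl c) (.inl d) ↔ d = τ c := by
  simp only [base, fromRel_adj, baseRel, ne_eq, Sum.inl.injEq]
  constructor
  · rintro ⟨-, rfl | rfl⟩
    · rfl
    · exact (h.involutive d).symm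
  · rintro rfl
    exact ⟨(h.ne c).symm, Or.inl rfl⟩

theorem base_adj_center_leaf {c : K} {x : X} :
    (base τ π F c₀ κ ω).Adj (.inl c) (.inr (.inl x)) ↔ π x = c := by
  simp [base, baseRel]

theorem base_adj_leaf_center {c : K} {x : X} :
    (base τ π F c₀ κ ω).Adj (.inr (.inl x)) (.inl c) ↔ π x = c := by
  simp [base, baseRel]

theorem base_adj_leaf_leaf {x y : X} :
    (base τ π F c₀ κ ω).Adj (.inr (.inl x)) (.inr (.inl y)) ↔ F.Adj x y := by
  simp only [base, fromRel_adj, baseRel, ne_eq, Sum.inr.injEq, Sum.inl.injEq]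
  exact ⟨fun h => h.2.elim id fun h => h.symm, fun h => ⟨h.ne, Or.inl h⟩⟩

theorem base_adj_clique_clique {i j : Fin κ} :
    (base τ π F c₀ κ ω).Adj (.inr (.inr (.inl i))) (.inr (.inr (.inl j))) ↔ i ≠ j := by
  simp [base, baseRel]

theorem base_adj_pendant_center {c : K} {i : Fin ω} :
    (base τ π F c₀ κ ω).Adj (.inr (.inr (.inr i))) (.inl c) ↔ c = c₀ := by
  simp [base, baseRel]

/-- With `s + 1` leaves, a center can avoid two given vertices as the middle of a spine and one as
an end. -/
theorem exists_leaves (h : IsBaseData τ π F κ s) (c : K) (S : Finset (K ⊕ X ⊕ Fin κ ⊕ Fin ω))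
    {m : ℕ} (hm : m + #S ≤ s + 1) :
    ∃ B : Finset (K ⊕ X ⊕ Fin κ ⊕ Fin ω), #B = m ∧
      ∀ v ∈ B, v ∉ S ∧ ∃ x, π x = c ∧ v = .inr (.inl x) := by
  classical
  obtain ⟨P, hP, hPc⟩ := h.card_fiber c
  let f : X → K ⊕ X ⊕ Fin κ ⊕ Fin ω := fun x => .inr (.inl x)
  have hf : Function.Injective f := fun x y hxy => by simpa [f] using hxy
  have hcard : m ≤ #((P.image f) \ S) := by
    have := Finset.le_card_sdiff S (P.image f)
    rw [Finset.card_image_of_injective _ hf] at this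
    omega
  obtain ⟨B, hB, hBm⟩ := Finset.exists_subset_card_eq hcard
  refine ⟨B, hBm, fun v hv => ?_⟩
  have := hB hv
  rw [Finset.mem_sdiff, Finset.mem_image] at this
  obtain ⟨⟨x, hx, rfl⟩, hS⟩ := this
  exact ⟨hS, x, hPc x hx, rfl⟩

theorem exists_leaf_nhds (h : IsBaseData τ π F κ s) (x : X) :
    ∃ N : Finset (K ⊕ X ⊕ Fin κ ⊕ Fin ω), #N + 1 = s ∧
      (∀ v ∈ N, ∃ y, F.Adj x y ∧ v = .inr (.inl y)) ∧ ∀ y, F.Adj x y → .inr (.inl y) ∈ N := by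
  classical
  obtain ⟨N, hN, hN'⟩ := h.card_nhds x
  refine ⟨N.image fun x => .inr (.inl x), ?_, ?_, ?_⟩
  · rwa [Finset.card_image_of_injective _ fun x y hxy => by simpa using hxy]
  · intro v hv
    obtain ⟨y, hy, rfl⟩ := Finset.mem_image.mp hv
    exact ⟨y, (hN' y).mp hy, rfl⟩
  · exact fun y hy => Finset.mem_image_of_mem _ ((hN' y).mpr hy)

section Extension

variable (h : IsBaseData τ π F κ s) (hle : base τ π F c₀ κ ω ≤ G)
include h hle

/-- The spine is `π x`, `x`, `τ (π x)`; the `s - 1` leaves joined to `x` by `F` hang on neither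
center. -/
theorem not_free_of_leaf_partner {x : X} (hadj : G.Adj (.inr (.inl x)) (.inl (τ (π x)))) :
    ¬ (caterpillar (s - 1)).Free G := by
  classical
  obtain ⟨N, hN, hN1, -⟩ := exists_leaf_nhds (κ := κ) (ω := ω) h x
  obtain ⟨A, hA, hA1⟩ := exists_leaves (ω := ω) (m := s) h (π x) {.inr (.inl x)} (by simp)
  obtain ⟨C, hC, hC1⟩ := exists_leaves (ω := ω) (m := s) h (τ (π x)) {.inr (.inl x)} (by simp)
  have hne := h.ne (π x)
  have hF := h.adj x
  have hl : ∀ {c z}, π z = c → G.Adj (.inl c) (.inr (.inl z)) := fun hz =>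
    hle (base_adj_center_leaf.mpr hz)
  refine IsCaterpillar.not_free (s := s) (a := .inl (π x)) (b := .inr (.inl x))
    (c := .inl (τ (π x))) (A := A) (B := N) (C := C) ⟨hl rfl, hadj, ?_, ?_, ?_, ?_, hA, hN, hC,
      ?_, ?_, ?_⟩
  · simpa using hne.symm
  · intro v hv
    obtain ⟨hv1, z, hz, rfl⟩ := hA1 v hv
    exact ⟨hl hz, by simpa using hv1, by simp⟩
  · intro v hv
    obtain ⟨z, hz, rfl⟩ := hN1 v hv
    exact ⟨hle (base_adj_leaf_leaf.mpr hz), by simp, by simp⟩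
  · intro v hv
    obtain ⟨hv1, z, hz, rfl⟩ := hC1 v hv
    exact ⟨hl hz, by simp, by simpa using hv1⟩
  · rw [Finset.disjoint_left]
    intro v hv hv'
    obtain ⟨-, z, hz, rfl⟩ := hA1 v hv
    obtain ⟨y, hy, hyz⟩ := hN1 _ hv'
    obtain rfl : z = y := by simpa using hyz
    exact (hF z hy).1 hz
  · rw [Finset.disjoint_left]
    intro v hv hv'
    obtain ⟨-, z, hz, rfl⟩ := hA1 v hv
    obtain ⟨-, y, hy, hyz⟩ := hC1 _ hv'
    obtain rfl : z = y := by simpa using hyz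
    exact hne (hy.symm.trans hz)
  · rw [Finset.disjoint_left]
    intro v hv hv'
    obtain ⟨z, hz, rfl⟩ := hN1 v hv
    obtain ⟨-, y, hy, hyz⟩ := hC1 _ hv'
    obtain rfl : z = y := by simpa using hyz
    exact (hF z hz).2 hy

/-- A vertex `v` adjacent to a center `c` becomes the end of the spine `v, c, τ c`,
provided that it has enough further neighbours away from the leaves of `c`. -/
theorem not_free_of_adj_center {c : K} {v : K ⊕ X ⊕ Fin κ ⊕ Fin ω} (hv : G.Adj v (.inl c))
    (hvτ : v ≠ .inl (τ c)) (y : K ⊕ X ⊕ Fin κ ⊕ Fin ω) {A : Finset (K ⊕ X ⊕ Fin κ ⊕ Fin ω)}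
    (hA : #A = s) (hs : 1 ≤ s)
    (hAv : ∀ u ∈ A, G.Adj v u ∧ u ≠ .inl c ∧ u ≠ .inl (τ c) ∧
      (u ≠ y → ∀ x, u = .inr (.inl x) → π x ≠ c ∧ π x ≠ τ c))
    (hvc : ∀ x, v = .inr (.inl x) → π x ≠ τ c) :
    ¬ (caterpillar (s - 1)).Free G := by
  classical
  -- `y` is the one vertex of `A` that may itself be a leaf of `c` or `τ c`, so `B` and `C` must
  -- avoid it.
  obtain ⟨B, hB, hB1⟩ := exists_leaves (ω := ω) (m := s - 1) h c {v, y}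
    (by have := Finset.card_le_two (a := v) (b := y); omega)
  obtain ⟨C, hC, hC1⟩ := exists_leaves (ω := ω) (m := s) h (τ c) {y} (by simp)
  have hne := h.ne c
  have hl : ∀ {c z}, π z = c → G.Adj (.inl c) (.inr (.inl z)) := fun hz =>
    hle (base_adj_center_leaf.mpr hz)
  refine IsCaterpillar.not_free (s := s) (a := v) (b := .inl c)
    (c := .inl (τ c)) (A := A) (B := B) (C := C) ⟨hv, hle ((base_adj_center_center h).mpr rfl),
      hvτ, ?_, ?_, ?_, hA, by omega, hC, ?_, ?_, ?_⟩
  · exact fun u hu => ⟨(hAv u hu).1, (hAv u hu).2.1, (hAv u hu).2.2.1⟩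
  · intro u hu
    obtain ⟨hu1, z, hz, rfl⟩ := hB1 u hu
    simp only [Finset.mem_insert, Finset.mem_singleton, not_or] at hu1
    exact ⟨hl hz, hu1.1, by simp⟩
  · intro u hu
    obtain ⟨hu1, z, hz, rfl⟩ := hC1 u hu
    exact ⟨hl hz, fun hzv => hvc z hzv.symm hz, by simp⟩
  · rw [Finset.disjoint_left]
    intro u hu hu'
    obtain ⟨hu1, z, hz, rfl⟩ := hB1 u hu'
    simp only [Finset.mem_insert, Finset.mem_singleton, not_or] at hu1
    exact ((hAv _ hu).2.2.2 hu1.2 z rfl).1 hz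
  · rw [Finset.disjoint_left]
    intro u hu hu'
    obtain ⟨hu1, z, hz, rfl⟩ := hC1 u hu'
    exact ((hAv _ hu).2.2.2 (by simpa using hu1) z rfl).2 hz
  · rw [Finset.disjoint_left]
    intro u hu hu'
    obtain ⟨-, z, hz, rfl⟩ := hB1 u hu
    obtain ⟨-, y, hy, hyz⟩ := hC1 _ hu'
    obtain rfl : z = y := by simpa using hyz
    exact hne (hy.symm.trans hz)

/-- Besides its center, a leaf has `s - 1` base neighbours; any new neighbour other than `τ (π x)`
completes them to the set `A` for the spine `x`, `π x`, `τ (π x)`. -/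
theorem base_adj_of_leaf_adj (hs : 1 ≤ s) (hfree : (caterpillar (s - 1)).Free G) {x : X}
    {y : K ⊕ X ⊕ Fin κ ⊕ Fin ω} (hadj : G.Adj (.inr (.inl x)) y) :
    (base τ π F c₀ κ ω).Adj (.inr (.inl x)) y := by
  classical
  by_contra hb
  by_cases hy : y = .inl (τ (π x))
  · subst hy
    exact not_free_of_leaf_partner h hle hadj hfree
  obtain ⟨N, hN, hN1, -⟩ := exists_leaf_nhds (κ := κ) (ω := ω) h x
  have hyN : y ∉ N := fun hyN => by
    obtain ⟨z, hz, rfl⟩ := hN1 y hyN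
    exact hb (base_adj_leaf_leaf.mpr hz)
  refine not_free_of_adj_center h hle (c := π x) (v := .inr (.inl x)) (y := y) (A := insert y N)
    (hle (base_adj_leaf_center.mpr rfl)) (by simp) (by rw [Finset.card_insert_of_notMem hyN, hN])
    hs ?_ ?_ hfree
  · intro u hu
    rw [Finset.mem_insert] at hu
    rcases hu with rfl | hu
    · refine ⟨hadj, ?_, hy, fun hne => (hne rfl).elim⟩
      rintro rfl
      exact hb (base_adj_leaf_center.mpr rfl)
    · obtain ⟨z, hz, rfl⟩ := hN1 u hu
      refine ⟨hle (base_adj_leaf_leaf.mpr hz), by simp, by simp, fun _ z' hz' => ?_⟩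
      obtain rfl : z = z' := by simpa using hz'
      exact h.adj x z hz
  · intro z hz
    obtain rfl : x = z := by simpa using hz
    exact (h.ne _).symm

theorem base_adj_of_center_adj_center (hs : 1 ≤ s) (hfree : (caterpillar (s - 1)).Free G) {c d : K}
    (hadj : G.Adj (.inl c) (.inl d)) : (base τ π F c₀ κ ω).Adj (.inl c) (.inl d) := by
  rw [base_adj_center_center h]
  by_contra hd
  obtain ⟨A, hA, hA1⟩ := exists_leaves (ω := ω) (m := s) h d ∅ (by simp)
  have hcd : c ≠ d := fun hcd => hadj.ne (by rw [hcd])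
  refine not_free_of_adj_center h hle (c := c) (v := .inl d) (y := .inl d) (A := A)
    hadj.symm (by simpa using hd) hA hs (fun u hu => ?_) (by simp) hfree
  obtain ⟨-, z, hz, rfl⟩ := hA1 u hu
  refine ⟨hle (base_adj_center_leaf.mpr hz), by simp, by simp, fun _ z' hz' => ?_⟩
  obtain rfl : z = z' := by simpa using hz'
  rw [hz]
  exact ⟨hcd.symm, hd⟩

theorem not_adj_center_clique (hs : 1 ≤ s) (hfree : (caterpillar (s - 1)).Free G) {c : K}
    {i : Fin κ} : ¬ G.Adj (.inl c) (.inr (.inr (.inl i))) := by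
  classical
  intro hadj
  have hκ : κ = s + 1 := h.card_clique.resolve_left (by rintro rfl; exact i.elim0)
  refine not_free_of_adj_center h hle (c := c) (v := .inr (.inr (.inl i))) (y := .inl c)
    (A := (univ.erase i).image fun j => .inr (.inr (.inl j)))
    hadj.symm (by simp) ?_ hs (fun u hu => ?_) (by simp) hfree
  · rw [Finset.card_image_of_injective _ fun x y hxy => by simpa using hxy,
      Finset.card_erase_of_mem (Finset.mem_univ _), Finset.card_univ, Fintype.card_fin, hκ]
    rfl
  · obtain ⟨j, hj, rfl⟩ := Finset.mem_image.mp hu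
    exact ⟨hle (base_adj_clique_clique.mpr (Finset.ne_of_mem_erase hj).symm), by simp, by simp,
      by simp⟩

theorem card_le_of_pendant_adj (hs : 1 ≤ s) (hfree : (caterpillar (s - 1)).Free G) {i : Fin ω}
    {S : Finset (K ⊕ X ⊕ Fin κ ⊕ Fin ω)} (hS : ∀ v, v ∈ S ↔ G.Adj (.inr (.inr (.inr i))) v) :
    #S ≤ s := by
  classical
  by_contra! hlt
  have hc₀ : G.Adj (.inr (.inr (.inr i))) (.inl c₀) := hle (base_adj_pendant_center.mpr rfl)
  have hleaf : ∀ x, ¬ G.Adj (.inr (.inr (.inr i))) (.inr (.inl x)) := fun x hx => by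
    have := base_adj_of_leaf_adj h hle hs hfree hx.symm
    simp [base, baseRel] at this
  -- If so, the pendant vertex is the middle of a spine between `c₀` and `τ c₀`; if not, it is the
  -- end of a spine through `c₀` and `τ c₀`.
  by_cases hτ : G.Adj (.inr (.inr (.inr i))) (.inl (τ c₀))
  · obtain ⟨A, hA, hA1⟩ := exists_leaves (ω := ω) (m := s) h c₀ ∅ (by simp)
    obtain ⟨C, hC, hC1⟩ := exists_leaves (ω := ω) (m := s) h (τ c₀) ∅ (by simp)
    obtain ⟨B, hBS, hB⟩ := Finset.exists_subset_card_eq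
      (show s - 1 ≤ #(S \ {.inl c₀, .inl (τ c₀)}) by
        have h1 := Finset.le_card_sdiff {.inl c₀, .inl (τ c₀)} S
        have h2 := Finset.card_le_two (a := (.inl c₀ : K ⊕ X ⊕ Fin κ ⊕ Fin ω)) (b := .inl (τ c₀))
        omega)
    have hB1 : ∀ v ∈ B, G.Adj (.inr (.inr (.inr i))) v ∧ v ≠ .inl c₀ ∧ v ≠ .inl (τ c₀) := by
      intro v hv
      have := hBS hv
      simp only [Finset.mem_sdiff, Finset.mem_insert, Finset.mem_singleton, not_or] at this
      exact ⟨(hS v).mp this.1, this.2⟩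
    refine IsCaterpillar.not_free (s := s) (a := .inl c₀) (b := .inr (.inr (.inr i)))
      (c := .inl (τ c₀)) (A := A) (B := B) (C := C) ⟨hc₀.symm, hτ, ?_, ?_, hB1, ?_, hA, by omega,
        hC, ?_, ?_, ?_⟩ hfree
    · simpa using (h.ne c₀).symm
    · intro v hv
      obtain ⟨-, z, hz, rfl⟩ := hA1 v hv
      exact ⟨hle (base_adj_center_leaf.mpr hz), by simp, by simp⟩
    · intro v hv
      obtain ⟨-, z, hz, rfl⟩ := hC1 v hv
      exact ⟨hle (base_adj_center_leaf.mpr hz), by simp, by simp⟩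
    · rw [Finset.disjoint_left]
      intro v hv hv'
      obtain ⟨-, z, hz, rfl⟩ := hA1 v hv
      exact hleaf z (hB1 _ hv').1
    · rw [Finset.disjoint_left]
      intro v hv hv'
      obtain ⟨-, z, hz, rfl⟩ := hA1 v hv
      obtain ⟨-, y, hy, hyz⟩ := hC1 _ hv'
      obtain rfl : z = y := by simpa using hyz
      exact h.ne c₀ (hy.symm.trans hz)
    · rw [Finset.disjoint_left]
      intro v hv hv'
      obtain ⟨-, z, hz, rfl⟩ := hC1 v hv'
      exact hleaf z (hB1 _ hv).1
  · obtain ⟨A, hAS, hA⟩ := Finset.exists_subset_card_eq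
      (show s ≤ #(S.erase (.inl c₀)) by
        rw [Finset.card_erase_of_mem ((hS _).mpr hc₀)]; omega)
    refine not_free_of_adj_center h hle hc₀ (by simp) (.inl c₀) hA hs (fun u hu => ?_)
      (by simp) hfree
    have := Finset.mem_erase.mp (hAS hu)
    have hu1 := (hS u).mp this.2
    refine ⟨hu1, this.1, ?_, ?_⟩
    · rintro rfl
      exact hτ hu1
    · rintro - x rfl
      exact (hleaf x hu1).elim

/-- An extension that contains no caterpillar has new edges only at pendant vertices. -/
theorem base_adj_or_pendant (hs : 1 ≤ s) (hfree : (caterpillar (s - 1)).Free G)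
    {u v : K ⊕ X ⊕ Fin κ ⊕ Fin ω} (hadj : G.Adj u v) :
    (base τ π F c₀ κ ω).Adj u v ∨ (∃ i, u = .inr (.inr (.inr i))) ∨
      ∃ i, v = .inr (.inr (.inr i)) := by
  rcases u with c | x | i | i <;> rcases v with d | y | j | j
  · exact Or.inl (base_adj_of_center_adj_center h hle hs hfree hadj)
  · exact Or.inl (base_adj_of_leaf_adj h hle hs hfree hadj.symm).symm
  · exact (not_adj_center_clique h hle hs hfree hadj).elim
  · simp
  · exact Or.inl (base_adj_of_leaf_adj h hle hs hfree hadj)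
  · exact Or.inl (base_adj_of_leaf_adj h hle hs hfree hadj)
  · exact Or.inl (base_adj_of_leaf_adj h hle hs hfree hadj)
  · simp
  · exact (not_adj_center_clique h hle hs hfree hadj.symm).elim
  · exact Or.inl (base_adj_of_leaf_adj h hle hs hfree hadj.symm).symm
  · exact Or.inl (base_adj_clique_clique.mpr fun hij => hadj.ne (by rw [hij]))
  all_goals simp

/-- `T` contains an end of every matching edge. The terms count the matching, the edges from centers
to leaves, `F`, the clique, and all edges at pendant vertices, old or new. -/
theorem ncard_edgeSet_le [Fintype K] [Fintype X] (hs : 1 ≤ s)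
    (hfree : (caterpillar (s - 1)).Free G) (T : Finset K) (hT : ∀ c, c ∈ T ∨ τ c ∈ T) :
    G.edgeSet.ncard ≤ #T + Fintype.card X + F.edgeSet.ncard + κ.choose 2 + ω * s := by
  classical
  let V := K ⊕ X ⊕ Fin κ ⊕ Fin ω
  let E₁ : Finset (Sym2 V) := T.image fun c => s(.inl c, .inl (τ c))
  let E₂ : Finset (Sym2 V) := univ.image fun x : X => s(.inl (π x), .inr (.inl x))
  let E₃ : Finset (Sym2 V) := F.edgeFinset.image (Sym2.map fun x => .inr (.inl x))
  let E₄ : Finset (Sym2 V) :=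
    (⊤ : SimpleGraph (Fin κ)).edgeFinset.image (Sym2.map fun i => .inr (.inr (.inl i)))
  let w : Fin ω → V := fun i => .inr (.inr (.inr i))
  let E₅ : Finset (Sym2 V) := univ.biUnion fun i => (univ.filter (G.Adj (w i))).image (s(w i, ·))
  have hE : G.edgeFinset ⊆ E₁ ∪ E₂ ∪ E₃ ∪ E₄ ∪ E₅ := by
    intro e
    induction e using Sym2.ind with | _ u v
    intro he
    have hadj : G.Adj u v := by simpa using he
    have h5 : ∀ i v, G.Adj (w i) v → s(w i, v) ∈ E₅ := fun i v hv =>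
      Finset.mem_biUnion.mpr ⟨i, Finset.mem_univ _, Finset.mem_image_of_mem _ (by simpa using hv)⟩
    rcases base_adj_or_pendant h hle hs hfree hadj with hb | ⟨i, rfl⟩ | ⟨i, rfl⟩
    swap
    · exact Finset.mem_union_right _ (h5 i v hadj)
    swap
    · rw [Sym2.eq_swap]
      exact Finset.mem_union_right _ (h5 i u hadj.symm)
    simp only [Finset.mem_union]
    have h2 : ∀ c x, π x = c → (s(.inl c, .inr (.inl x)) : Sym2 V) ∈ E₂ := by
      rintro _ x rfl
      exact Finset.mem_image_of_mem _ (Finset.mem_univ x)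
    rcases u with c | x | i | i <;> rcases v with d | y | j | j
    · obtain rfl := (base_adj_center_center h).mp hb
      refine Or.inl (Or.inl (Or.inl (Or.inl ?_)))
      rcases hT c with hc | hc
      · exact Finset.mem_image_of_mem _ hc
      · refine Finset.mem_image.mpr ⟨τ c, hc, ?_⟩
        rw [h.involutive c, Sym2.eq_swap]
    · exact Or.inl (Or.inl (Or.inl (Or.inr (h2 c y (base_adj_center_leaf.mp hb)))))
    · simp [base, baseRel] at hb
    · rw [Sym2.eq_swap]
      exact Or.inr (h5 j _ hadj.symm)
    · rw [Sym2.eq_swap]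
      exact Or.inl (Or.inl (Or.inl (Or.inr (h2 d x (base_adj_leaf_center.mp hb)))))
    · refine Or.inl (Or.inl (Or.inr (Finset.mem_image.mpr ⟨s(x, y), ?_, rfl⟩)))
      simpa using base_adj_leaf_leaf.mp hb
    · simp [base, baseRel] at hb
    · rw [Sym2.eq_swap]
      exact Or.inr (h5 j _ hadj.symm)
    · simp [base, baseRel] at hb
    · simp [base, baseRel] at hb
    · refine Or.inl (Or.inr (Finset.mem_image.mpr ⟨s(i, j), ?_, rfl⟩))
      simpa using base_adj_clique_clique.mp hb
    · rw [Sym2.eq_swap]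
      exact Or.inr (h5 j _ hadj.symm)
    all_goals exact Or.inr (h5 i _ hadj)
  have h₁ : #E₁ ≤ #T := Finset.card_image_le
  have h₂ : #E₂ ≤ Fintype.card X := Finset.card_image_le
  have h₃ : #E₃ ≤ F.edgeSet.ncard := by
    rw [← F.coe_edgeFinset, Set.ncard_coe_finset]
    exact Finset.card_image_le
  have h₄ : #E₄ ≤ κ.choose 2 := by
    refine Finset.card_image_le.trans ?_
    rw [card_edgeFinset_top_eq_card_choose_two, Fintype.card_fin]
  have h₅ : #E₅ ≤ ω * s := by
    refine (Finset.card_biUnion_le_card_mul _ _ s fun i _ => ?_).trans (by simp)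
    exact Finset.card_image_le.trans (card_le_of_pendant_adj h hle hs hfree (i := i) fun v => by simp [w])
  rw [← G.coe_edgeFinset, Set.ncard_coe_finset]
  refine (Finset.card_le_card hE).trans ?_
  have := Finset.card_union_le (E₁ ∪ E₂ ∪ E₃ ∪ E₄) E₅
  have := Finset.card_union_le (E₁ ∪ E₂ ∪ E₃) E₄
  have := Finset.card_union_le (E₁ ∪ E₂) E₃
  have := Finset.card_union_le E₁ E₂
  omega

end Extension

theorem base_eq_center_of_card_nhds (h : IsBaseData τ π F κ s) (hs : 1 ≤ s)
    {v : K ⊕ X ⊕ Fin κ ⊕ Fin ω} {S : Finset (K ⊕ X ⊕ Fin κ ⊕ Fin ω)}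
    (hS : #S = s + 1 ∧ ∀ u ∈ S, (base τ π F c₀ κ ω).Adj v u) : ∃ c, v = .inl c := by
  classical
  obtain ⟨hS, hadj⟩ := hS
  rcases v with c | x | i | i
  · exact ⟨c, rfl⟩
  · exfalso
    obtain ⟨N, hN, -, hN2⟩ := exists_leaf_nhds (κ := κ) (ω := ω) h x
    have hsub : S ⊆ insert (.inl (π x)) N := by
      intro u hu
      have hu := hadj u hu
      rw [Finset.mem_insert]
      rcases u with c | y | i | i
      · exact Or.inl (by rw [base_adj_leaf_center.mp hu])
      · exact Or.inr (hN2 y (base_adj_leaf_leaf.mp hu))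
      · simp [base, baseRel] at hu
      · simp [base, baseRel] at hu
    have h1 := Finset.card_le_card hsub
    have h2 := Finset.card_insert_le (.inl (π x)) N
    omega
  · exfalso
    have hκ : κ = s + 1 := h.card_clique.resolve_left (by rintro rfl; exact i.elim0)
    have hsub : S ⊆ (univ.erase i).image fun j => .inr (.inr (.inl j)) := by
      intro u hu
      have hu := hadj u hu
      rcases u with c | y | j | j
      · simp [base, baseRel] at hu
      · simp [base, baseRel] at hu
      · exact Finset.mem_image_of_mem _
          (Finset.mem_erase.mpr ⟨(base_adj_clique_clique.mp hu).symm, Finset.mem_univ _⟩)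
      · simp [base, baseRel] at hu
    have h1 := (Finset.card_le_card hsub).trans Finset.card_image_le
    rw [Finset.card_erase_of_mem (Finset.mem_univ _), Finset.card_univ, Fintype.card_fin] at h1
    omega
  · exfalso
    have hsub : S ⊆ {.inl c₀} := by
      intro u hu
      have hu := hadj u hu
      rcases u with c | y | j | j
      · rw [base_adj_pendant_center.mp hu]
        exact Finset.mem_singleton_self _
      all_goals simp [base, baseRel] at hu
    have h1 := Finset.card_le_card hsub
    rw [Finset.card_singleton] at h1
    omega

/-- All spine vertices would be centers, but the centers induce a matching, which has no path on
three vertices. -/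
theorem base_free (h : IsBaseData τ π F κ s) (hs : 1 ≤ s) :
    (caterpillar (s - 1)).Free (base τ π F c₀ κ ω) := by
  classical
  refine by_contra fun hfree => ?_
  obtain ⟨a, b, c, A, B, C, hcat⟩ := exists_isCaterpillar_of_not_free hs hfree
  obtain ⟨a, rfl⟩ := base_eq_center_of_card_nhds h hs hcat.exists_nhds_left
  obtain ⟨b, rfl⟩ := base_eq_center_of_card_nhds h hs hcat.exists_nhds_middle
  obtain ⟨c, rfl⟩ := base_eq_center_of_card_nhds h hs hcat.reverse.exists_nhds_left
  have h1 := (base_adj_center_center h).mp hcat.adj_ab.symm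
  have h2 := (base_adj_center_center h).mp hcat.adj_bc
  exact hcat.ne_ac (by rw [h1, h2])

theorem exists_isSaturated_ge {W V : Type*} [Finite V] {H : SimpleGraph W} {G₀ : SimpleGraph V}
    (hG₀ : H.Free G₀) : ∃ G, G₀ ≤ G ∧ IsSaturated H G := by
  obtain ⟨G, hle, hG⟩ := (Set.toFinite {G : SimpleGraph V | H.Free G}).exists_le_maximal hG₀
  refine ⟨G, hle, hG.prop, fun x y hxy hadj hfree => hadj ?_⟩
  exact hG.le_of_ge hfree le_sup_left (Or.inr (by simp [SimpleGraph.edge_adj, hxy]))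

theorem sat_le_of_isBaseData [Fintype K] [Fintype X] (h : IsBaseData τ π F κ s) (hs : 1 ≤ s)
    (c₀ : K) (ω : ℕ) (T : Finset K) (hT : ∀ c, c ∈ T ∨ τ c ∈ T) {n : ℕ}
    (hn : Fintype.card K + (Fintype.card X + (κ + ω)) = n) :
    sat n (caterpillar (s - 1)) ≤
      #T + Fintype.card X + F.edgeSet.ncard + κ.choose 2 + ω * s := by
  classical
  let e : (K ⊕ X ⊕ Fin κ ⊕ Fin ω) ≃ Fin n := Fintype.equivFinOfCardEq (by simp [hn])
  let i₀ := Iso.map e (base τ π F c₀ κ ω)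
  have hf : (caterpillar (s - 1)).Free ((base τ π F c₀ κ ω).map e.toEmbedding) :=
    (free_congr_right i₀).mp (base_free h hs)
  obtain ⟨G, hle, hG⟩ := exists_isSaturated_ge hf
  let i := Iso.comap e G
  have hfree : (caterpillar (s - 1)).Free (G.comap e) := (free_congr_right i).mpr hG.1
  have hle' : base τ π F c₀ κ ω ≤ G.comap e := fun u v huv => hle (i₀.map_adj_iff.mpr huv)
  have hcard : (G.comap e).edgeSet.ncard = G.edgeSet.ncard := by
    rw [← (G.comap e).coe_edgeFinset, ← G.coe_edgeFinset, Set.ncard_coe_finset,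
      Set.ncard_coe_finset, i.card_edgeFinset_eq]
  have hsat : sat n (caterpillar (s - 1)) ≤ (G.comap e).edgeSet.ncard :=
    Nat.sInf_le ⟨G, hG, hcard.symm⟩
  exact hsat.trans (ncard_edgeSet_le h hle' hs hfree T hT)

end Construction

/-! ### Regular bipartite graphs between the two sides of each block -/

section Blocks

variable {k : ℕ} (g : Fin k → ℕ) (r : ℕ)

/-- The circulant relation inside each block, which relates every element to `r` others. -/
def circulant (p q : Σ i, Fin (g i)) : Prop :=
  p.1 = q.1 ∧ (g p.1 - p.2.val + q.2.val) % g p.1 < r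

/-- The bipartite graph on two copies of the blocks given by the circulant relation. -/
def blockGraph : SimpleGraph ((Σ i, Fin (g i)) × Bool) where
  Adj p q := (p.2 = false ∧ q.2 = true ∧ circulant g r p.1 q.1) ∨
    (p.2 = true ∧ q.2 = false ∧ circulant g r q.1 p.1)
  symm := ⟨fun p q h => by tauto⟩
  loopless := ⟨fun p h => by grind⟩

variable {g r}

theorem card_filter_val_lt {m : ℕ} (hr : r ≤ m) (e : Fin m ≃ Fin m) :
    #{q : Fin m | (e q).val < r} = r := by
  rw [← Fintype.card_subtype, Fintype.card_congr (e.subtypeEquiv (q := fun q => q.val < r)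
    fun _ => Iff.rfl), Fintype.card_subtype, Fin.card_filter_val_lt, min_eq_right hr]

theorem exists_finset_circulant_right (hr : ∀ i, r ≤ g i) (p : Σ i, Fin (g i)) :
    ∃ N : Finset (Σ i, Fin (g i)), #N = r ∧ ∀ q, q ∈ N ↔ circulant g r p q := by
  obtain ⟨i, p⟩ := p
  have : NeZero (g i) := ⟨by have := p.2; omega⟩
  refine ⟨(univ.filter fun q => (Equiv.subRight p q).val < r).map
    (Function.Embedding.sigmaMk i), ?_, ?_⟩
  · rw [Finset.card_map, card_filter_val_lt (hr i)]
  · rintro ⟨j, q⟩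
    constructor
    · intro hq
      obtain ⟨q', hq', he⟩ := Finset.mem_map.mp hq
      cases he
      refine ⟨rfl, ?_⟩
      simpa [Fin.val_sub] using hq'
    · rintro ⟨rfl, hq⟩
      refine Finset.mem_map.mpr ⟨q, ?_, rfl⟩
      simpa [Fin.val_sub] using hq

theorem exists_finset_circulant_left (hr : ∀ i, r ≤ g i) (q : Σ i, Fin (g i)) :
    ∃ N : Finset (Σ i, Fin (g i)), #N = r ∧ ∀ p, p ∈ N ↔ circulant g r p q := by
  obtain ⟨i, q⟩ := q
  have : NeZero (g i) := ⟨by have := q.2; omega⟩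
  refine ⟨(univ.filter fun p => (Equiv.subLeft q p).val < r).map
    (Function.Embedding.sigmaMk i), ?_, ?_⟩
  · rw [Finset.card_map, card_filter_val_lt (hr i)]
  · rintro ⟨j, p⟩
    constructor
    · intro hp
      obtain ⟨p', hp', he⟩ := Finset.mem_map.mp hp
      cases he
      refine ⟨rfl, ?_⟩
      simpa [Fin.val_sub] using hp'
    · rintro ⟨h, hp⟩
      obtain rfl : j = i := h
      refine Finset.mem_map.mpr ⟨p, ?_, rfl⟩
      simpa [Fin.val_sub] using hp

theorem exists_finset_blockGraph (hr : ∀ i, r ≤ g i) (p : (Σ i, Fin (g i)) × Bool) :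
    ∃ N : Finset ((Σ i, Fin (g i)) × Bool), #N = r ∧ ∀ q, q ∈ N ↔ (blockGraph g r).Adj p q := by
  obtain ⟨p, b⟩ := p
  cases b
  · obtain ⟨N, hN, hN'⟩ := exists_finset_circulant_right hr p
    refine ⟨N ×ˢ {true}, by simpa using hN, ?_⟩
    rintro ⟨q, b⟩
    cases b <;> simp [blockGraph, hN']
  · obtain ⟨N, hN, hN'⟩ := exists_finset_circulant_left hr p
    refine ⟨N ×ˢ {false}, by simpa using hN, ?_⟩
    rintro ⟨q, b⟩
    cases b <;> simp [blockGraph, hN']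

theorem ncard_edgeSet_blockGraph (hr : ∀ i, r ≤ g i) :
    (blockGraph g r).edgeSet.ncard = (∑ i, g i) * r := by
  classical
  have hd : ∀ v, (blockGraph g r).degree v = r := fun v => by
    obtain ⟨N, hN, hN'⟩ := exists_finset_blockGraph hr v
    rw [← card_neighborFinset_eq_degree,
      show (blockGraph g r).neighborFinset v = N by ext q; rw [mem_neighborFinset, hN'], hN]
  have := (blockGraph g r).sum_degrees_eq_twice_card_edges
  simp only [hd, Finset.sum_const, Finset.card_univ, Fintype.card_prod, Fintype.card_sigma,
    Fintype.card_fin, Fintype.card_bool, smul_eq_mul] at this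
  rw [← (blockGraph g r).coe_edgeFinset, Set.ncard_coe_finset]
  linarith

end Blocks

/-! ### Matching the centers across blocks -/

section Centers

variable {k : ℕ} [NeZero k]

/-- The matching of the centers: the center of the left side of each block is matched with the
center of the right side of the next block. -/
def shiftPartner (c : Fin k × Bool) : Fin k × Bool :=
  if c.2 then (c.1 - 1, false) else (c.1 + 1, true)

theorem shiftPartner_involutive : Function.Involutive (shiftPartner (k := k)) := by
  rintro ⟨i, b⟩
  cases b <;> simp [shiftPartner]

theorem shiftPartner_fst_ne (hk : 2 ≤ k) (c : Fin k × Bool) : (shiftPartner c).1 ≠ c.1 := by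
  obtain ⟨i, b⟩ := c
  have h1 : (1 : Fin k) ≠ 0 := by
    intro h
    have := congrArg Fin.val h
    rw [Fin.val_one', Fin.val_zero, Nat.mod_eq_of_lt (by omega)] at this
    omega
  cases b <;> simp [shiftPartner, h1]

/-- Edges between leaves stay in a block and switch sides, while the matching changes the block; so
a neighbour of a leaf belongs neither to its center nor to that center's partner. -/
theorem isBaseData_blockGraph (hk : 2 ≤ k) {s : ℕ} (hs : 1 ≤ s) {g : Fin k → ℕ}
    (hg : ∀ i, s + 1 ≤ g i) {κ : ℕ} (hκ : κ = 0 ∨ κ = s + 1) :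
    IsBaseData (shiftPartner (k := k)) (fun x : (Σ i, Fin (g i)) × Bool => (x.1.1, x.2))
      (blockGraph g (s - 1)) κ s where
  involutive := shiftPartner_involutive
  ne c h := shiftPartner_fst_ne hk c (congrArg Prod.fst h)
  card_nhds x := by
    obtain ⟨N, hN, hN'⟩ := exists_finset_blockGraph (r := s - 1) (fun i => by have := hg i; omega) x
    exact ⟨N, by omega, hN'⟩
  adj := by
    rintro ⟨p, b⟩ ⟨q, b'⟩ h
    have hpq : q.1 = p.1 ∧ b' ≠ b := by
      rcases h with ⟨h1, h2, h3, -⟩ | ⟨h1, h2, h3, -⟩ <;> simp_all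
    refine ⟨fun h => hpq.2 (congrArg Prod.snd h), fun h => ?_⟩
    exact shiftPartner_fst_ne hk (p.1, b) ((congrArg Prod.fst h).symm.trans hpq.1)
  card_fiber c := by
    refine ⟨univ.map ⟨fun q : Fin (g c.1) => ((⟨c.1, q⟩ : Σ i, Fin (g i)), c.2),
      fun _ _ h => by simpa using h⟩, ?_, ?_⟩
    · simpa using hg c.1
    · intro x hx
      obtain ⟨q, -, rfl⟩ := Finset.mem_map.mp hx
      rfl
  card_clique := hκ

end Centers

/-! ### The numerical bounds -/

theorem sat_le_of_blocks {k s t κ ω n : ℕ} (hk : 2 ≤ k) (hs : 1 ≤ s) (hκ : κ = 0 ∨ κ = s + 1)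
    (hn : k * (2 * s + 4) + 2 * t + κ + ω = n) :
    sat n (caterpillar (s - 1)) ≤ k + (k * (s + 1) + t) * (s + 1) + κ.choose 2 + ω * s := by
  have : NeZero k := ⟨by omega⟩
  -- Each side of a block has `s + 1` leaves and one center; the `2 * t` surplus leaves all go to
  -- block `0`, `t` on each side.
  let g : Fin k → ℕ := fun i => s + 1 + if i = 0 then t else 0
  have hg : ∀ i, s + 1 ≤ g i := fun i => Nat.le_add_right _ _
  have hsum : ∑ i, g i = k * (s + 1) + t := by simp [g, Finset.sum_add_distrib]
  have hX : Fintype.card ((Σ i, Fin (g i)) × Bool) = (k * (s + 1) + t) * 2 := by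
    simp [Fintype.card_sigma, hsum]
  have h := sat_le_of_isBaseData (isBaseData_blockGraph hk hs hg hκ) hs (0, false) ω
    (univ ×ˢ {false})
    (by rintro ⟨i, b⟩; cases b <;> simp [shiftPartner]) (n := n) (by
      rw [hX, ← hn]
      simp
      ring)
  rw [ncard_edgeSet_blockGraph (fun i => by have := hg i; omega), hX, hsum] at h
  obtain ⟨s, rfl⟩ := Nat.exists_eq_add_of_le' hs
  simp only [Finset.card_product, Finset.card_singleton, mul_one, Finset.card_univ, Fintype.card_fin, Nat.add_sub_cancel] at h ⊢
  refine h.trans (le_of_eq ?_)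
  ring

theorem sat_upper_bound {s n : ℕ} (hs : 1 ≤ s) (hn : 2 * (2 * s + 4) ≤ n) :
    2 * (s + 2) * sat n (caterpillar (s - 1)) ≤ (s ^ 2 + 2 * s + 2) * n + 2 * s * (s + 1) := by
  have hk : 2 ≤ n / (2 * s + 4) := (Nat.le_div_iff_mul_le (by omega)).mpr hn
  have hr : n % (2 * s + 4) < 2 * s + 4 := Nat.mod_lt _ (by omega)
  have hdiv := Nat.div_add_mod n (2 * s + 4)
  set k := n / (2 * s + 4)
  set r := n % (2 * s + 4)
  -- Surplus leaves cost more than the asymptotic rate, so a large remainder first gives up `s + 1`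
  -- vertices to a clique, whose degree `s` is below that rate. An odd vertex left over becomes
  -- pendant.
  rcases le_or_gt r s with hrs | hrs
  · have hsat := sat_le_of_blocks (t := r / 2) (κ := 0) (ω := r % 2) hk hs (Or.inl rfl) (n := n)
      (by rw [mul_comm k]; omega)
    obtain ht := Nat.div_add_mod r 2
    have hω : r % 2 < 2 := Nat.mod_lt _ (by omega)
    generalize r / 2 = t at *
    generalize r % 2 = ω at *
    rw [Nat.choose_eq_zero_of_lt (by omega)] at hsat
    refine (Nat.mul_le_mul_left _ hsat).trans ?_
    rw [← hdiv, ← ht]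
    have hts : 2 * t + ω ≤ s := by omega
    interval_cases ω <;> nlinarith
  · have hsat := sat_le_of_blocks (t := (r - (s + 1)) / 2) (κ := s + 1) (ω := (r - (s + 1)) % 2)
      hk hs (Or.inr rfl) (n := n) (by rw [mul_comm k]; omega)
    obtain ht := Nat.div_add_mod (r - (s + 1)) 2
    have hω : (r - (s + 1)) % 2 < 2 := Nat.mod_lt _ (by omega)
    generalize (r - (s + 1)) / 2 = t at *
    generalize (r - (s + 1)) % 2 = ω at *
    have hc : 2 * (s + 1).choose 2 = (s + 1) * s := by
      rw [Nat.choose_two_right]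
      exact Nat.mul_div_cancel' (by simpa [mul_comm] using (Nat.even_mul_succ_self s).two_dvd)
    have hts : 2 * t + ω ≤ s + 2 := by omega
    have hr' : r = 2 * t + ω + (s + 1) := by omega
    refine (Nat.mul_le_mul_left _ hsat).trans ?_
    rw [← hdiv, hr']
    generalize (s + 1).choose 2 = x at *
    interval_cases ω <;> nlinarith

theorem sat_lower_bound {s : ℕ} (hs : 1 ≤ s) (n : ℕ) :
    4 * (2 * n - (2 * s + 3)) - (s + 3) * (s + 1) ^ 2 ≤
      4 * (s + 3) * (2 * (sat n (caterpillar (s - 1)) : ℤ) - s * n) := by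
  classical
  -- A saturated graph must exist for the infimum to be attained; over the empty set `sInf` would be
  -- `0`.
  have hne : caterpillar (s - 1) ≠ ⊥ := by
    intro h
    have hadj : (caterpillar (s - 1)).Adj (.inl 0) (.inl 1) := by simp [caterpillar, pathGraph_adj]
    rw [h] at hadj
    exact hadj
  obtain ⟨G₀, hG₀⟩ := exists_isSaturated (V := Fin n) _ hne
  obtain ⟨G, hG, hcard⟩ : ∃ G : SimpleGraph (Fin n), IsSaturated (caterpillar (s - 1)) G ∧
      G.edgeSet.ncard = sat n (caterpillar (s - 1)) :=
    Nat.sInf_mem (s := {m : ℕ | ∃ G : SimpleGraph (Fin n),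
      IsSaturated (caterpillar (s - 1)) G ∧ G.edgeSet.ncard = m}) ⟨_, G₀, hG₀, rfl⟩
  have h := hG.sum_degree_ge hs
  rw [Finset.sum_sub_distrib, ← Nat.cast_sum, G.sum_degrees_eq_twice_card_edges,
    ← Set.ncard_coe_finset, G.coe_edgeFinset, hcard] at h
  simpa [mul_comm (s : ℤ)] using h

end SaturationNumber

theorem mainTheorem5 (s n : ℕ) (hs : 1 ≤ s)
    (hn : max 2 ((s - 1) / 2) * (2 * s + 4) + s + 1 ≤ n) :
    ((s : ℝ) + 2 / ((s : ℝ) + 3)) * ((n : ℝ) / 2)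
        - ((2 * (s : ℝ) + 3) / (2 * (s : ℝ) + 6) + ((s : ℝ) + 1) ^ 2 / 8)
      ≤ (SaturationNumber.sat n (SaturationNumber.caterpillar (s - 1)) : ℝ) ∧
    (SaturationNumber.sat n (SaturationNumber.caterpillar (s - 1)) : ℝ)
      ≤ ((s : ℝ) + 2 / ((s : ℝ) + 2)) * ((n : ℝ) / 2)
        + (s : ℝ) * ((s : ℝ) + 1) / ((s : ℝ) + 2) := by
  constructor
  · have h := SaturationNumber.sat_lower_bound hs n
    generalize SaturationNumber.sat n (SaturationNumber.caterpillar (s - 1)) = m at *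
    have h' : (4 * (2 * n - (2 * s + 3)) - (s + 3) * (s + 1) ^ 2 : ℝ) ≤
        4 * (s + 3) * (2 * m - s * n) := by exact_mod_cast h
    have e : ((s : ℝ) + 2 / ((s : ℝ) + 3)) * ((n : ℝ) / 2)
        - ((2 * (s : ℝ) + 3) / (2 * (s : ℝ) + 6) + ((s : ℝ) + 1) ^ 2 / 8) =
        s * n / 2 + (4 * (2 * n - (2 * s + 3)) - (s + 3) * (s + 1) ^ 2) / (8 * (s + 3)) := by
      have h6 : (2 * (s : ℝ) + 6) = 2 * (s + 3) := by ring
      rw [h6]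
      field_simp
      ring
    have h8 : (4 * (2 * n - (2 * s + 3)) - (s + 3) * (s + 1) ^ 2 : ℝ) / (8 * (s + 3)) ≤
        m - s * n / 2 := by
      rw [div_le_iff₀ (by positivity)]
      linarith
    linarith
  · have hn' : 2 * (2 * s + 4) ≤ n := by
      have := Nat.mul_le_mul_right (2 * s + 4) (le_max_left 2 ((s - 1) / 2))
      omega
    have h := SaturationNumber.sat_upper_bound hs hn'
    generalize SaturationNumber.sat n (SaturationNumber.caterpillar (s - 1)) = m at *
    have h' : (2 * (s + 2) * m : ℝ) ≤ (s ^ 2 + 2 * s + 2) * n + 2 * s * (s + 1) := by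
      exact_mod_cast h
    have e : ((s : ℝ) + 2 / ((s : ℝ) + 2)) * ((n : ℝ) / 2) + (s : ℝ) * ((s : ℝ) + 1) / (s + 2) =
        ((s ^ 2 + 2 * s + 2) * n + 2 * s * (s + 1)) / (2 * (s + 2)) := by
      field_simp
    rw [e, le_div_iff₀ (by positivity)]
    linarith
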